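/- A diffeological vector space is a real vector space with a diffeology for which addition and scalar multiplication are smooth; these objects and the smooth linear maps form the category $\mathrm{DVect}$. Subspaces, products and quotients carry the sub-, product and quotient diffeology, and the space $L^\infty(V,W)$ of smooth linear maps $V\to W$ carries the functional diffeology. A sequence $0\to A\xrightarrow{i}V\xrightarrow{p}B\to 0$ in $\mathrm{DVect}$ is a short exact sequence if it is a short exact sequence of vector spaces, $i$ is an induction ($A$ has the diffeology induced from $V$) and $p$ is a subduction ($B$ has the quotient diffeology from $V$). A diffeological vector space $P$ is projective if every smooth linear map $P\to W_2$ lifts through every linear subduction $W_1\to W_2$. A diffeological projective resolution $\mathbf P(V)\to V$ is a complex $\cdots\to P_1\to P_0\xrightarrow{\varepsilon}V\to 0$ in $\mathrm{DVect}$ with all $P_n$ projective which is exact at every spot, where $X\xrightarrow{f}Y\xrightarrow{g}Z$ is exact at $Y$ if $0\to X/\ker f\to Y\to\operatorname{im}g\to 0$ is a short exact sequence in $\mathrm{DVect}$. Finally $\mathrm{Ext}^n(V,W):=H^n(L^\infty(\mathbf P(V),W))=\ker d^n/\operatorname{im}d^{n-1}$, with the quotient diffeology of the sub-diffeology. **Theorem.**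 (a) Every diffeological vector space has a diffeological projective resolution. For every smooth linear map $f:V\to V'$ and all diffeological projective resolutions of $V$ and $V'$, there is a chain map $\mathbf P(V)\to\mathbf P(V')$ in $\mathrm{DVect}$ extending $f$, and for every diffeological vector space $W$ the smooth linear maps $f^*:\mathrm{Ext}^n(V',W)\to\mathrm{Ext}^n(V,W)$ obtained by composition with it do not depend on its choice. (b) Let $0\to V_1\xrightarrow{i}V_2\xrightarrow{\pi}V_3\to 0$ be a short exact sequence in $\mathrm{DVect}$ and let $W$ be a diffeological vector space. Fix diffeological projective resolutions of $V_1$ and $V_3$. There are smooth linear maps $\delta^0:L^\infty(V_1,W)\to\mathrm{Ext}^1(V_3,W)$ and $\delta^n:\mathrm{Ext}^n(V_1,W)\to\mathrm{Ext}^{n+1}(V_3,W)$, $n\ge 1$, such that, for every diffeological projective resolution of $V_2$, the sequence $$0\to L^\infty(V_3,W)\xrightarrow{\pi^*}L^\infty(V_2,W)\xrightarrow{i^*}L^\infty(V_1,W)\xrightarrow{\delta^0}\mathrm{Ext}^1(V_3,W)\xrightarrow{\pi^*}\mathrm{Ext}^1(V_2,W)\xrightarrow{i^*}\mathrm{Ext}^1(V_1,W)\xrightarrow{\delta^1}\mathrm{Ext}^2(V_3,W)\xrightarrow{\pi^*}\mathrm{Ext}^2(V_2,W)\to\cdots$$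 of diffeological vector spaces and smooth linear maps is exact as a sequence of vector spaces. Moreover the $\delta^n$ are the usual connecting maps: whenever chain maps $I$ and $J$ extending $i$ and $\pi$ form a short exact sequence $0\to P^{(1)}_n\xrightarrow{I_n}P^{(2)}_n\xrightarrow{J_n}P^{(3)}_n\to 0$ in $\mathrm{DVect}$ in every degree $n$, one has $\delta^n[a]=[c]$ for all cocycles $a\in L^\infty(P^{(1)}_n,W)$, $c\in L^\infty(P^{(3)}_{n+1},W)$ and every $b\in L^\infty(P^{(2)}_n,W)$ with $b\circ I_n=a$ and $b\circ d=c\circ J_{n+1}$; for $n=0$, $\delta^0(a)=[c]$ for $a\in L^\infty(V_1,W)$ under the same conditions with $a\circ\varepsilon$ in place of $a$. -/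

import Mathlib

open Diffeology
open scoped ContDiff Topology

universe u

noncomputable section

namespace DiffVS

/-! ### Products, subspaces, inductions and subductions -/

/-- The product diffeology: a map into `X × Y` is a plot iff both components are plots. -/
instance prodDiffeology (X Y : Type*) [DiffeologicalSpace X] [DiffeologicalSpace Y] :
    DiffeologicalSpace (X × Y) where
  plots _ := {p | IsPlot (fun x ↦ (p x).1) ∧ IsPlot (fun x ↦ (p x).2)}
  constant_plots _ := ⟨isPlot_const, isPlot_const⟩
  plot_reparam hp hf := ⟨isPlot_reparam hp.1 hf, isPlot_reparam hp.2 hf⟩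
  locality hp := by
    constructor
    · refine DiffeologicalSpace.locality fun x ↦ ?_
      obtain ⟨s, hs, hx, h⟩ := hp x
      exact ⟨s, hs, hx, fun hf hc ↦ (h hf hc).1⟩
    · refine DiffeologicalSpace.locality fun x ↦ ?_
      obtain ⟨s, hs, hx, h⟩ := hp x
      exact ⟨s, hs, hx, fun hf hc ↦ (h hf hc).2⟩

/-- An induction: an injective map `f : X → Y` such that the diffeology of `X` is the one induced
from `Y` (the sub-diffeology, when `X` is identified with its image). -/
def IsInduction {X Y : Type*} [DiffeologicalSpace X] [DiffeologicalSpace Y] (f : X → Y) : Prop :=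
  Function.Injective f ∧
    ∀ (n : ℕ) (p : EuclideanSpace ℝ (Fin n) → X), IsPlot p ↔ IsPlot (f ∘ p)

/-- A subduction: a smooth surjection `f : X → Y` such that the diffeology of `Y` is the quotient
diffeology, i.e. the plots of `Y` are exactly the maps that locally lift to plots of `X`. -/
def IsSubduction {X Y : Type*} [DiffeologicalSpace X] [DiffeologicalSpace Y] (f : X → Y) : Prop :=
  Function.Surjective f ∧ DSmooth f ∧
    ∀ (n : ℕ) (p : EuclideanSpace ℝ (Fin n) → Y), IsPlot p →
      ∀ x, ∃ q : EuclideanSpace ℝ (Fin n) → X, IsPlot q ∧ f ∘ q =ᶠ[𝓝 x] p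

/-- A smooth self-map of a Euclidean space which is the identity near `x` and takes values in a
given neighbourhood of `x`. -/
theorem exists_smooth_retract {n : ℕ} {s : Set (EuclideanSpace ℝ (Fin n))} (hs : IsOpen s)
    {x : EuclideanSpace ℝ (Fin n)} (hx : x ∈ s) :
    ∃ g : EuclideanSpace ℝ (Fin n) → EuclideanSpace ℝ (Fin n),
      ContDiff ℝ ∞ g ∧ (∀ y, g y ∈ s) ∧ g =ᶠ[𝓝 x] id := by
  obtain ⟨ε, hε, hsub⟩ := Metric.isOpen_iff.mp hs x hx
  let χ : ContDiffBump x := ⟨ε / 2, ε, by positivity, by linarith⟩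
  refine ⟨fun y ↦ x + χ y • (y - x), ?_, fun y ↦ hsub ?_, ?_⟩
  · exact contDiff_const.add (χ.contDiff.smul (contDiff_id.sub contDiff_const))
  · rw [Metric.mem_ball, dist_eq_norm, add_sub_cancel_left, norm_smul, Real.norm_eq_abs,
      abs_of_nonneg χ.nonneg]
    by_cases hy : y ∈ Metric.ball x ε
    · rw [Metric.mem_ball, dist_eq_norm] at hy
      calc χ y * ‖y - x‖ ≤ 1 * ‖y - x‖ := by
            gcongr
            exact χ.le_one
        _ < ε := by simpa using hy
    · have : χ y = 0 := χ.zero_of_le_dist (by simpa [Metric.mem_ball] using hy)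
      simpa [this] using hε
  · filter_upwards [χ.eventuallyEq_one] with y hy
    simp [hy]

/-- Plots are detected locally, by agreement with plots. -/
theorem isPlot_of_local {X : Type*} [DiffeologicalSpace X] {n : ℕ}
    {p : EuclideanSpace ℝ (Fin n) → X}
    (h : ∀ x, ∃ q : EuclideanSpace ℝ (Fin n) → X, IsPlot q ∧ q =ᶠ[𝓝 x] p) : IsPlot p := by
  refine DiffeologicalSpace.locality fun x ↦ ?_
  obtain ⟨q, hq, he⟩ := h x
  obtain ⟨s, hsub, hs, hx⟩ := eventually_nhds_iff.mp he
  refine ⟨s, hs, hx, fun {m f} hf hc ↦ ?_⟩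
  have : p ∘ f = q ∘ f := funext fun y ↦ (hsub _ (hf y)).symm
  rw [this]
  exact isPlot_reparam hq hc

/-! ### Diffeological vector spaces -/

/-- A real vector space with a diffeology for which addition and scalar multiplication are
smooth. -/
class DiffVectorSpace (V : Type*) [AddCommGroup V] [Module ℝ V] [DiffeologicalSpace V] :
    Prop where
  dSmooth_add : DSmooth fun x : V × V ↦ x.1 + x.2
  dSmooth_smul : DSmooth fun x : ℝ × V ↦ x.1 • x.2

section Constructions

variable {V V' W : Type*}
  [AddCommGroup V] [Module ℝ V] [DiffeologicalSpace V] [DiffVectorSpace V]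
  [AddCommGroup V'] [Module ℝ V'] [DiffeologicalSpace V'] [DiffVectorSpace V']
  [AddCommGroup W] [Module ℝ W] [DiffeologicalSpace W] [DiffVectorSpace W]

theorem isPlot_add {n : ℕ} {p q : EuclideanSpace ℝ (Fin n) → V} (hp : IsPlot p) (hq : IsPlot q) :
    IsPlot fun x ↦ p x + q x :=
  DiffVectorSpace.dSmooth_add n (fun x ↦ (p x, q x)) ⟨hp, hq⟩

theorem isPlot_smul {n : ℕ} {r : EuclideanSpace ℝ (Fin n) → ℝ}
    {p : EuclideanSpace ℝ (Fin n) → V} (hr : IsPlot r) (hp : IsPlot p) :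
    IsPlot fun x ↦ r x • p x :=
  DiffVectorSpace.dSmooth_smul n (fun x ↦ (r x, p x)) ⟨hr, hp⟩

/-- The sub-diffeology on a linear subspace. -/
instance subDiffeology (S : Submodule ℝ V) : DiffeologicalSpace S where
  plots _ := {p | IsPlot fun x ↦ (p x : V)}
  constant_plots _ := isPlot_const
  plot_reparam hp hf := isPlot_reparam hp hf
  locality hp := by
    refine DiffeologicalSpace.locality fun x ↦ ?_
    obtain ⟨s, hs, hx, h⟩ := hp x
    exact ⟨s, hs, hx, fun hf hc ↦ h hf hc⟩

instance (S : Submodule ℝ V) : DiffVectorSpace S where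
  dSmooth_add _ _ hp := isPlot_add (V := V) hp.1 hp.2
  dSmooth_smul _ _ hp := isPlot_smul (V := V) hp.1 hp.2

/-- The quotient diffeology on a quotient vector space: plots are the maps that locally lift to
plots of `V`. -/
instance quotientDiffeology (S : Submodule ℝ V) : DiffeologicalSpace (V ⧸ S) where
  plots n := {p | ∀ x, ∃ q : EuclideanSpace ℝ (Fin n) → V, IsPlot q ∧ S.mkQ ∘ q =ᶠ[𝓝 x] p}
  constant_plots v x := by
    obtain ⟨w, rfl⟩ := S.mkQ_surjective v
    exact ⟨fun _ ↦ w, isPlot_const, Filter.EventuallyEq.rfl⟩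
  plot_reparam := fun {n m p f} hp hf x ↦ by
    obtain ⟨q, hq, he⟩ := hp (f x)
    exact ⟨q ∘ f, isPlot_reparam hq hf, he.comp_tendsto hf.continuous.continuousAt⟩
  locality := fun {n p} hp x ↦ by
    obtain ⟨s, hs, hx, h⟩ := hp x
    obtain ⟨g, hg, hgs, he⟩ := exists_smooth_retract hs hx
    obtain ⟨q, hq, he'⟩ := h hgs hg x
    refine ⟨q, hq, he'.trans ?_⟩
    filter_upwards [he] with y hy
    simp [hy]

instance (S : Submodule ℝ V) : DiffVectorSpace (V ⧸ S) where
  dSmooth_add n p hp x := by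
    obtain ⟨q₁, hq₁, h₁⟩ := hp.1 x
    obtain ⟨q₂, hq₂, h₂⟩ := hp.2 x
    refine ⟨fun y ↦ q₁ y + q₂ y, isPlot_add hq₁ hq₂, ?_⟩
    filter_upwards [h₁, h₂] with y hy₁ hy₂
    simp only [Function.comp_apply] at hy₁ hy₂ ⊢
    rw [map_add, hy₁, hy₂]
  dSmooth_smul n p hp x := by
    obtain ⟨q, hq, h⟩ := hp.2 x
    refine ⟨fun y ↦ (p y).1 • q y, isPlot_smul hp.1 hq, ?_⟩
    filter_upwards [h] with y hy
    simp only [Function.comp_apply] at hy ⊢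
    rw [map_smul, hy]

theorem dSmooth_mkQ {V : Type*} [AddCommGroup V] [Module ℝ V] [DiffeologicalSpace V]
    [DiffVectorSpace V] (S : Submodule ℝ V) : DSmooth S.mkQ :=
  fun _ p hp _ ↦ ⟨p, hp, Filter.EventuallyEq.rfl⟩

variable (V W) in
/-- `Linfty V W` is the vector space of smooth linear maps `V → W`. -/
def Linfty : Submodule ℝ (V →ₗ[ℝ] W) where
  carrier := {f | DSmooth f}
  zero_mem' := dSmooth_const
  add_mem' hf hg := fun n p hp ↦ isPlot_add (hf n p hp) (hg n p hp)
  smul_mem' c _ hf := fun n p hp ↦ isPlot_smul (r := fun _ ↦ c) isPlot_const (hf n p hp)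

instance : FunLike (Linfty V W) V W where
  coe f := f.1
  coe_injective _ _ h := Subtype.ext (DFunLike.coe_injective h)

/-- The functional diffeology on `Linfty V W`: a map `p` from a Euclidean space `E` is a plot iff
the map `E × V → W`, `(x, v) ↦ p x v`, is smooth. -/
instance functionalDiffeology : DiffeologicalSpace (Linfty V W) where
  plots n := {p | DSmooth fun x : EuclideanSpace ℝ (Fin n) × V ↦ p x.1 x.2}
  constant_plots f := fun n p hp ↦ f.2 n _ hp.2
  plot_reparam := fun {n m p f} hp hf k q hq ↦
    hp k (fun y ↦ (f (q y).1, (q y).2)) ⟨(hf.comp hq.1.contDiff).isPlot, hq.2⟩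
  locality := fun {n p} hp k q hq ↦ by
    refine DiffeologicalSpace.locality fun y ↦ ?_
    obtain ⟨s, hs, hx, h⟩ := hp (q y).1
    have hq1 : ContDiff ℝ ∞ fun y ↦ (q y).1 := hq.1.contDiff
    refine ⟨(fun y ↦ (q y).1) ⁻¹' s, hs.preimage hq1.continuous, hx, fun {m f} hf hc ↦ ?_⟩
    exact h (f := fun z ↦ (q (f z)).1) hf (hq1.comp hc) m (fun z ↦ (z, (q (f z)).2))
      ⟨isPlot_id, isPlot_reparam hq.2 hc⟩

instance : DiffVectorSpace (Linfty V W) where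
  dSmooth_add _ _ hp k q hq := isPlot_add (hp.1 k q hq) (hp.2 k q hq)
  dSmooth_smul _ _ hp k q hq :=
    isPlot_smul (isPlot_reparam hp.1 hq.1.contDiff) (hp.2 k q hq)

/-- Composition of smooth linear maps. -/
def scomp (g : Linfty V' W) (f : Linfty V V') : Linfty V W :=
  ⟨g.1 ∘ₗ f.1, fun n p hp ↦ g.2 n _ (f.2 n p hp)⟩

infixr:80 " ∘ₛ " => scomp

/-- The smooth linear map `f^* : L^∞(V', W) → L^∞(V, W)`, `g ↦ g ∘ f`. -/
def precomp (W : Type*) [AddCommGroup W] [Module ℝ W] [DiffeologicalSpace W] [DiffVectorSpace W]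
    (f : Linfty V V') : Linfty (Linfty V' W) (Linfty V W) :=
  ⟨{ toFun := fun g ↦ g ∘ₛ f
     map_add' := fun _ _ ↦ rfl
     map_smul' := fun _ _ ↦ rfl },
   fun _ _ hp k q hq ↦ hp k (fun y ↦ ((q y).1, f (q y).2)) ⟨hq.1, f.2 _ _ hq.2⟩⟩

/-- `0 → A → V → B → 0` is a short exact sequence of diffeological vector spaces: it is short
exact as a sequence of vector spaces, `i` is an induction and `p` is a subduction. -/
structure IsShortExact (i : V →ₗ[ℝ] V') (p : V' →ₗ[ℝ] W) : Prop where
  injective : Function.Injective i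
  exact : Function.Exact i p
  surjective : Function.Surjective p
  induction : IsInduction i
  subduction : IsSubduction p

/-- Exactness of `V → V' → W` (maps `f`, `g`) at `V'`, in the diffeological sense: the sequence
`0 → V ⧸ ker f → V' → im g → 0` is a short exact sequence of diffeological vector spaces. -/
def IsExactAt (f : V →ₗ[ℝ] V') (g : V' →ₗ[ℝ] W) : Prop :=
  IsShortExact ((LinearMap.ker f).liftQ f le_rfl) g.rangeRestrict

end Constructions

/-- Objects of the category of diffeological vector spaces. -/
structure DVect where
  /-- the underlying set -/
  carrier : Type u
  [addCommGroup : AddCommGroup carrier]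
  [module : Module ℝ carrier]
  [diffeology : DiffeologicalSpace carrier]
  [diffVectorSpace : DiffVectorSpace carrier]

attribute [instance] DVect.addCommGroup DVect.module DVect.diffeology DVect.diffVectorSpace

instance : CoeSort DVect.{u} (Type u) := ⟨DVect.carrier⟩

/-- Projectivity with respect to linear subductions. -/
def IsProjective (P : DVect.{u}) : Prop :=
  ∀ (W₁ W₂ : DVect.{u}) (f : Linfty W₁ W₂) (g : Linfty P W₂), IsSubduction f →
    ∃ h : Linfty P W₁, f ∘ₛ h = g

/-! ### Cochain complexes and their cohomology -/

/-- Cochain complexes of diffeological vector spaces, concentrated in degrees `≥ 0`. -/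
structure DCochain where
  /-- the terms -/
  X : ℕ → DVect.{u}
  /-- the coboundary maps -/
  d : ∀ n, Linfty (X n) (X (n + 1))
  d_comp_d : ∀ n, d (n + 1) ∘ₛ d n = 0

namespace DCochain

variable (C D : DCochain.{u})

/-- The cocycles in degree `n`, with the sub-diffeology. -/
def cocycles (n : ℕ) : Submodule ℝ (C.X n) := LinearMap.ker (C.d n).1

/-- The coboundaries in degree `n`, as a subspace of the cocycles. -/
def coboundaries : ∀ n : ℕ, Submodule ℝ (C.cocycles n)
  | 0 => ⊥
  | n + 1 => (LinearMap.range (C.d n).1).submoduleOf (C.cocycles (n + 1))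

/-- The cohomology `Hⁿ(C) = ker dⁿ / im dⁿ⁻¹`, with the quotient diffeology. -/
abbrev H (n : ℕ) : DVect.{u} := ⟨C.cocycles n ⧸ C.coboundaries n⟩

/-- The class of a cocycle. -/
def cls (n : ℕ) : Linfty (C.cocycles n) (C.H n) := ⟨(C.coboundaries n).mkQ, dSmooth_mkQ _⟩

/-- Cochain maps. -/
structure Hom where
  /-- the components -/
  f : ∀ n, Linfty (C.X n) (D.X n)
  comm : ∀ n, D.d n ∘ₛ f n = f (n + 1) ∘ₛ C.d n

variable {C D}

theorem Hom.comm_apply (F : Hom C D) (n : ℕ) (x : C.X n) :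
    D.d n (F.f n x) = F.f (n + 1) (C.d n x) :=
  DFunLike.congr_fun (F.comm n) x

/-- The map on cocycles induced by a cochain map. -/
def Hom.cocycleMap (F : Hom C D) (n : ℕ) : C.cocycles n →ₗ[ℝ] D.cocycles n :=
  (F.f n).1.restrict fun x hx ↦ by
    have hx' : C.d n x = 0 := hx
    change D.d n (F.f n x) = 0
    rw [F.comm_apply, hx']
    exact map_zero (F.f (n + 1)).1

theorem Hom.coboundaries_le (F : Hom C D) (n : ℕ) :
    C.coboundaries n ≤ (D.coboundaries n).comap (F.cocycleMap n) := by
  cases n with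
  | zero => exact bot_le
  | succ n =>
    rintro ⟨x, hx⟩ ⟨y, hy⟩
    exact ⟨F.f n y, (F.comm_apply n y).trans (congrArg (F.f (n + 1)) hy)⟩

/-- The map on cohomology induced by a cochain map: `[a] ↦ [F a]`. -/
def Hom.map (F : Hom C D) (n : ℕ) : Linfty (C.H n) (D.H n) :=
  ⟨(C.coboundaries n).mapQ (D.coboundaries n) (F.cocycleMap n) (F.coboundaries_le n), by
    intro k p hp x
    obtain ⟨q, hq, he⟩ := hp x
    refine ⟨F.cocycleMap n ∘ q, (F.f n).2 k _ hq, ?_⟩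
    filter_upwards [he] with y hy
    exact congrArg
      ((C.coboundaries n).mapQ (D.coboundaries n) (F.cocycleMap n) (F.coboundaries_le n)) hy⟩

end DCochain

/-! ### Projective resolutions and Ext -/

/-- A diffeological projective resolution `⋯ → P₁ → P₀ → V → 0`: every `Pₙ` is projective, and
the complex is exact at every spot (at the spot `V` this says that `V` is the quotient of `P₀`,
i.e. that the augmentation `ε` is a linear subduction). -/
structure ProjRes (V : DVect.{u}) where
  /-- the terms -/
  X : ℕ → DVect.{u}
  /-- the boundary maps -/
  d : ∀ n, Linfty (X (n + 1)) (X n)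
  /-- the augmentation -/
  ε : Linfty (X 0) V
  projective : ∀ n, IsProjective (X n)
  subduction_ε : IsSubduction ε
  exact_zero : IsExactAt (d 0).1 ε.1
  exact_succ : ∀ n, IsExactAt (d (n + 1)).1 (d n).1

theorem ProjRes.d_comp_d {V : DVect.{u}} (P : ProjRes V) (n : ℕ) :
    P.d n ∘ₛ P.d (n + 1) = 0 := by
  refine DFunLike.ext _ _ fun x ↦ ?_
  have h := ((P.exact_succ n).exact (P.d (n + 1) x)).mpr ⟨Submodule.Quotient.mk x, rfl⟩
  exact congrArg Subtype.val h

/-- The cochain complex `L^∞(P(V), W)` of a projective resolution `P(V) → V`. -/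
abbrev ProjRes.homComplex {V : DVect.{u}} (P : ProjRes V) (W : DVect.{u}) : DCochain.{u} where
  X n := ⟨Linfty (P.X n) W⟩
  d n := precomp W (P.d n)
  d_comp_d n := by
    refine DFunLike.ext _ _ fun g ↦ DFunLike.ext _ _ fun x ↦ ?_
    have h : P.d n (P.d (n + 1) x) = 0 := DFunLike.congr_fun (P.d_comp_d n) x
    exact (congrArg g h).trans (map_zero g.1)

/-- `Ext P W n` is the diffeological vector space `Extⁿ(V, W) = Hⁿ(L^∞(P(V), W))`, computed with
the diffeological projective resolution `P` of `V`. -/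
abbrev Ext {V : DVect.{u}} (P : ProjRes V) (W : DVect.{u}) (n : ℕ) : DVect.{u} :=
  (P.homComplex W).H n

/-- Chain maps `P → Q` between resolutions of `V` and `V'` that extend `f : V → V'`. -/
structure ProjRes.Lift {V V' : DVect.{u}} (f : Linfty V V') (P : ProjRes V) (Q : ProjRes V') where
  /-- the components -/
  hom : ∀ n, Linfty (P.X n) (Q.X n)
  comm_ε : Q.ε ∘ₛ hom 0 = f ∘ₛ P.ε
  comm_d : ∀ n, Q.d n ∘ₛ hom (n + 1) = hom n ∘ₛ P.d n

/-- The cochain map `L^∞(Q, W) → L^∞(P, W)` given by composition with a chain map `P → Q`. -/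
def ProjRes.Lift.cochainMap {V V' : DVect.{u}} {f : Linfty V V'} {P : ProjRes V} {Q : ProjRes V'}
    (F : ProjRes.Lift f P Q) (W : DVect.{u}) :
    DCochain.Hom (Q.homComplex W) (P.homComplex W) where
  f n := precomp W (F.hom n)
  comm n := by
    refine DFunLike.ext _ _ fun (g : Linfty (Q.X n) W) ↦ DFunLike.ext _ _ fun x ↦ ?_
    exact (congrArg g (DFunLike.congr_fun (F.comm_d n) x)).symm

/-- The map `f^* : Extⁿ(V', W) → Extⁿ(V, W)`, `[a] ↦ [a ∘ Fₙ]`, for a chain map `F` extending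
`f : V → V'`. -/
def ProjRes.Lift.extMap {V V' : DVect.{u}} {f : Linfty V V'} {P : ProjRes V} {Q : ProjRes V'}
    (F : ProjRes.Lift f P Q) (W : DVect.{u}) (n : ℕ) : Linfty (Ext Q W n) (Ext P W n) :=
  (F.cochainMap W).map n

end DiffVS

end

open DiffVS

set_option linter.unusedSectionVars false

noncomputable section

namespace DiffVS

/-! ### Smooth linear maps and global lifts of plots -/

section Basic

variable {V V' W U : Type*}
  [AddCommGroup V] [Module ℝ V] [DiffeologicalSpace V] [DiffVectorSpace V]
  [AddCommGroup V'] [Module ℝ V'] [DiffeologicalSpace V'] [DiffVectorSpace V']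
  [AddCommGroup W] [Module ℝ W] [DiffeologicalSpace W] [DiffVectorSpace W]
  [AddCommGroup U] [Module ℝ U] [DiffeologicalSpace U] [DiffVectorSpace U]

instance : LinearMapClass (Linfty V W) ℝ V W where
  map_add f := map_add f.1
  map_smulₛₗ f := map_smul f.1

@[ext]
theorem Linfty.ext {f g : Linfty V W} (h : ∀ x, f x = g x) : f = g := DFunLike.ext _ _ h

@[simp] theorem coe_val_apply (f : Linfty V W) (x : V) : f.1 x = f x := rfl
@[simp] theorem scomp_apply (g : Linfty V' W) (f : Linfty V V') (x : V) : (g ∘ₛ f) x = g (f x) :=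
  rfl
@[simp] theorem precomp_apply (f : Linfty V V') (g : Linfty V' W) : precomp W f g = g ∘ₛ f := rfl
@[simp] theorem Linfty.add_apply (f g : Linfty V W) (x : V) : (f + g) x = f x + g x := rfl
@[simp] theorem Linfty.sub_apply (f g : Linfty V W) (x : V) : (f - g) x = f x - g x := rfl
@[simp] theorem Linfty.neg_apply (f : Linfty V W) (x : V) : (-f) x = -f x := rfl
@[simp] theorem Linfty.zero_apply (x : V) : (0 : Linfty V W) x = 0 := rfl

/-- The identity as a smooth linear map. -/
def sid (V : Type*) [AddCommGroup V] [Module ℝ V] [DiffeologicalSpace V] [DiffVectorSpace V] :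
    Linfty V V := ⟨LinearMap.id, dSmooth_id⟩

@[simp] theorem sid_apply (x : V) : sid V x = x := rfl

theorem isPlot_map (f : Linfty V W) {n : ℕ} {p : EuclideanSpace ℝ (Fin n) → V}
    (hp : IsPlot p) : IsPlot fun x ↦ f (p x) := f.2 n p hp

theorem isPlot_sub {n : ℕ} {p q : EuclideanSpace ℝ (Fin n) → V} (hp : IsPlot p)
    (hq : IsPlot q) : IsPlot fun x ↦ p x - q x := by
  have := isPlot_add hp (isPlot_smul (r := fun _ ↦ -1) isPlot_const hq)
  simpa [sub_eq_add_neg] using this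

theorem isPlot_sum {n : ℕ} {ι : Type*} (s : Finset ι) {p : ι → EuclideanSpace ℝ (Fin n) → V}
    (hp : ∀ i ∈ s, IsPlot (p i)) : IsPlot fun x ↦ ∑ i ∈ s, p i x := by
  classical
  induction s using Finset.induction_on with
  | empty => simpa using isPlot_const
  | insert a s ha ih =>
    simp only [Finset.sum_insert ha]
    exact isPlot_add (hp a (by simp)) (ih fun i hi ↦ hp i (by simp [hi]))

/-- Plots lift globally, and not only locally, through linear subductions: local lifts are glued
with a smooth partition of unity. -/
theorem IsSubduction.exists_lift {f : V →ₗ[ℝ] W} (hf : IsSubduction f) {n : ℕ}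
    {p : EuclideanSpace ℝ (Fin n) → W} (hp : IsPlot p) :
    ∃ q : EuclideanSpace ℝ (Fin n) → V, IsPlot q ∧ ∀ x, f (q x) = p x := by
  choose q hq he using hf.2.2 n p hp
  choose s hs hso hxs using fun x ↦ eventually_nhds_iff.mp (he x)
  obtain ⟨ρ, hρ⟩ := SmoothPartitionOfUnity.exists_isSubordinate
    (modelWithCornersSelf ℝ (EuclideanSpace ℝ (Fin n))) isClosed_univ s hso
    (fun x _ ↦ Set.mem_iUnion.mpr ⟨x, hxs x⟩)
  refine ⟨fun x ↦ ∑ᶠ i, ρ i x • q i x, isPlot_of_local fun x ↦ ?_, fun x ↦ ?_⟩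
  · obtain ⟨t, ht, hfin⟩ := ρ.locallyFinite x
    refine ⟨fun y ↦ ∑ i ∈ hfin.toFinset, ρ i y • q i y, isPlot_sum _ fun i _ ↦
      isPlot_smul (ContDiff.isPlot (ρ i).contMDiff.contDiff) (hq i), ?_⟩
    filter_upwards [ht] with y hy
    refine (finsum_eq_sum_of_support_subset _ fun i hi ↦ ?_).symm
    rw [Set.Finite.coe_toFinset]
    refine ⟨y, fun h0 ↦ hi ?_, hy⟩
    simp only at h0 ⊢
    rw [h0, zero_smul]
  · have hfs : (Function.support fun i ↦ ρ i x).Finite := ρ.locallyFinite.point_finite x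
    have hsub : (Function.support fun i ↦ ρ i x • q i x) ⊆ hfs.toFinset := by
      rw [Set.Finite.coe_toFinset]
      exact Function.support_smul_subset_left _ _
    simp only
    rw [finsum_eq_sum_of_support_subset _ hsub, map_sum]
    have h1 : ∑ i ∈ hfs.toFinset, ρ i x = 1 := by
      rw [← finsum_eq_sum_of_support_subset _ (by rw [Set.Finite.coe_toFinset])]
      exact ρ.sum_eq_one (Set.mem_univ x)
    rw [← one_smul ℝ (p x), ← h1, Finset.sum_smul]
    refine Finset.sum_congr rfl fun i hi ↦ ?_
    rw [map_smul]
    have hne : ρ i x ≠ 0 := by simpa using hi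
    have := hs i x (hρ i (subset_tsupport _ hne))
    rw [← this]
    rfl

/-- Exactness of `V → V' → W` at `V'` on plots. -/
structure PlotExact (f : Linfty V V') (g : Linfty V' W) : Prop where
  comp_apply : ∀ x, g (f x) = 0
  exists_lift : ∀ {n : ℕ} {p : EuclideanSpace ℝ (Fin n) → V'}, IsPlot p →
    (∀ x, g (p x) = 0) → ∃ q : EuclideanSpace ℝ (Fin n) → V, IsPlot q ∧ ∀ x, f (q x) = p x

theorem isSubduction_of_lift {f : Linfty V W}
    (h : ∀ {n : ℕ} {p : EuclideanSpace ℝ (Fin n) → W}, IsPlot p →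
      ∃ q : EuclideanSpace ℝ (Fin n) → V, IsPlot q ∧ ∀ x, f (q x) = p x) : IsSubduction f := by
  refine ⟨fun w ↦ ?_, f.2, fun n p hp x ↦ ?_⟩
  · obtain ⟨q, -, hq⟩ := h (n := 0) (p := fun _ ↦ w) isPlot_const
    exact ⟨q 0, hq 0⟩
  · obtain ⟨q, hq, he⟩ := h hp
    exact ⟨q, hq, Filter.Eventually.of_forall he⟩

theorem isSubduction_mkQ (S : Submodule ℝ V) : IsSubduction S.mkQ :=
  ⟨S.mkQ_surjective, dSmooth_mkQ S, fun _ _ hp x ↦ hp x⟩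

theorem PlotExact.exact {f : Linfty V V'} {g : Linfty V' W} (h : PlotExact f g) (y : V')
    (hy : g y = 0) : ∃ x, f x = y := by
  obtain ⟨q, -, hq⟩ := h.exists_lift (n := 0) (p := fun _ ↦ y) isPlot_const fun _ ↦ hy
  exact ⟨q 0, hq 0⟩

theorem IsExactAt.plotExact {f : Linfty V V'} {g : Linfty V' W} (h : IsExactAt f.1 g.1) :
    PlotExact f g := by
  refine ⟨fun x ↦ ?_, fun {n p} hp h0 ↦ ?_⟩
  · exact congrArg Subtype.val ((h.exact (f x)).mpr ⟨Submodule.Quotient.mk x, rfl⟩)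
  · have hr (x) : p x ∈ Set.range ((LinearMap.ker f.1).liftQ f.1 le_rfl) :=
      (h.exact (p x)).mp (Subtype.ext (h0 x))
    choose r hr using hr
    obtain ⟨q, hq, he⟩ := (isSubduction_mkQ (LinearMap.ker f.1)).exists_lift
      ((h.induction.2 n r).mpr (by convert hp; exact funext hr))
    refine ⟨q, hq, fun x ↦ ?_⟩
    rw [← hr x, ← he x]
    rfl

/-- Exactness on plots implies exactness in the diffeological sense, provided that the plots of
`W` with values in the image of `g` lift to `V'`. -/
theorem PlotExact.isExactAt {f : Linfty V V'} {g : Linfty V' W} (h : PlotExact f g)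
    (hg : ∀ {n : ℕ} {p : EuclideanSpace ℝ (Fin n) → W}, IsPlot p → (∀ x, ∃ y, g y = p x) →
      ∃ q : EuclideanSpace ℝ (Fin n) → V', IsPlot q ∧ ∀ x, g (q x) = p x) :
    IsExactAt f.1 g.1 := by
  have hinj : Function.Injective ((LinearMap.ker f.1).liftQ f.1 le_rfl) :=
    LinearMap.ker_eq_bot.mp (Submodule.ker_liftQ_eq_bot _ _ _ le_rfl)
  refine ⟨hinj, fun y ↦ ⟨fun hy ↦ ?_, ?_⟩, LinearMap.surjective_rangeRestrict _, ⟨hinj, ?_⟩, ?_⟩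
  · obtain ⟨x, rfl⟩ := h.exact y (congrArg Subtype.val hy)
    exact ⟨Submodule.Quotient.mk x, rfl⟩
  · rintro ⟨x, rfl⟩
    obtain ⟨x, rfl⟩ := Submodule.Quotient.mk_surjective _ x
    exact Subtype.ext (h.comp_apply x)
  · intro n p
    constructor
    · intro hp
      refine isPlot_of_local fun x ↦ ?_
      obtain ⟨q, hq, he⟩ := hp x
      refine ⟨fun y ↦ f (q y), isPlot_map f hq, ?_⟩
      filter_upwards [he] with y hy
      exact congrArg ((LinearMap.ker f.1).liftQ f.1 le_rfl) hy
    · intro hp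
      obtain ⟨q, hq, he⟩ := h.exists_lift hp fun x ↦ by
        obtain ⟨y, hy⟩ := Submodule.Quotient.mk_surjective _ (p x)
        simp only [Function.comp_apply, ← hy]
        exact h.comp_apply y
      have : p = (LinearMap.ker f.1).mkQ ∘ q := funext fun x ↦ hinj (he x).symm
      rw [this]
      exact dSmooth_mkQ _ n q hq
  · refine ⟨LinearMap.surjective_rangeRestrict _, fun n p hp ↦ g.2 n p hp, fun n p hp x ↦ ?_⟩
    obtain ⟨q, hq, he⟩ := hg (p := fun x ↦ (p x : W)) hp fun x ↦ (p x).2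
    exact ⟨q, hq, Filter.Eventually.of_forall fun x ↦ Subtype.ext (he x)⟩

/-- Smooth linear maps factor through linear subductions. -/
theorem IsSubduction.exists_factor {f : Linfty V W} (hf : IsSubduction f) (g : Linfty V U)
    (h : ∀ x, f x = 0 → g x = 0) : ∃ k : Linfty W U, k ∘ₛ f = g := by
  let k : W →ₗ[ℝ] U := (LinearMap.ker f.1).liftQ g.1 (fun x hx ↦ h x hx) ∘ₗ
    (f.1.quotKerEquivOfSurjective hf.1).symm.toLinearMap
  have hk (x : V) : k (f x) = g x := by
    have : (f.1.quotKerEquivOfSurjective hf.1).symm (f x) = Submodule.Quotient.mk x :=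
      (LinearEquiv.symm_apply_eq _).mpr rfl
    simp only [k, LinearMap.comp_apply, LinearEquiv.coe_coe, this]
    rfl
  refine ⟨⟨k, fun n p hp ↦ ?_⟩, Linfty.ext hk⟩
  obtain ⟨q, hq, he⟩ := IsSubduction.exists_lift (f := f.1) hf hp
  have : k ∘ p = fun x ↦ g (q x) := funext fun x ↦ (congrArg k (he x).symm).trans (hk _)
  exact this ▸ isPlot_map g hq

/-- Smooth linear maps into the kernel of `p` factor through the kernel `i` of `p`. -/
theorem IsShortExact.exists_factor {i : Linfty V V'} {p : Linfty V' W} (h : IsShortExact i.1 p.1)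
    (g : Linfty U V') (hg : ∀ x, p (g x) = 0) : ∃ k : Linfty U V, i ∘ₛ k = g := by
  have hx (x) : ∃ y, i y = g x := (h.exact (g x)).mp (hg x)
  choose k hk using hx
  have hi : ∀ a b, i a = i b → a = b := fun a b hab ↦ h.injective hab
  refine ⟨⟨{ toFun := k, map_add' := fun x y ↦ hi _ _ ?_, map_smul' := fun c x ↦ hi _ _ ?_ },
    fun n q hq ↦ (h.induction.2 n _).mpr ?_⟩, Linfty.ext hk⟩
  · simp [hk]
  · simp [hk]
  · have : IsPlot fun x ↦ i (k (q x)) := by simpa only [hk] using isPlot_map g hq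
    exact this

theorem IsShortExact.comp_apply {i : Linfty V V'} {p : Linfty V' W} (h : IsShortExact i.1 p.1)
    (x : V) : p (i x) = 0 := (h.exact (i x)).mpr ⟨x, rfl⟩

instance : DiffVectorSpace (V × W) where
  dSmooth_add _ _ hp := ⟨isPlot_add hp.1.1 hp.2.1, isPlot_add hp.1.2 hp.2.2⟩
  dSmooth_smul _ _ hp := ⟨isPlot_smul hp.1 hp.2.1, isPlot_smul hp.1 hp.2.2⟩

/-- The first inclusion into a product. -/
def sinl (V W : Type*) [AddCommGroup V] [Module ℝ V] [DiffeologicalSpace V] [DiffVectorSpace V]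
    [AddCommGroup W] [Module ℝ W] [DiffeologicalSpace W] [DiffVectorSpace W] :
    Linfty V (V × W) := ⟨LinearMap.inl ℝ V W, fun _ _ hp ↦ ⟨hp, isPlot_const⟩⟩

/-- The second inclusion into a product. -/
def sinr (V W : Type*) [AddCommGroup V] [Module ℝ V] [DiffeologicalSpace V] [DiffVectorSpace V]
    [AddCommGroup W] [Module ℝ W] [DiffeologicalSpace W] [DiffVectorSpace W] :
    Linfty W (V × W) := ⟨LinearMap.inr ℝ V W, fun _ _ hp ↦ ⟨isPlot_const, hp⟩⟩

/-- The first projection of a product. -/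
def sfst (V W : Type*) [AddCommGroup V] [Module ℝ V] [DiffeologicalSpace V] [DiffVectorSpace V]
    [AddCommGroup W] [Module ℝ W] [DiffeologicalSpace W] [DiffVectorSpace W] :
    Linfty (V × W) V := ⟨LinearMap.fst ℝ V W, fun _ _ hp ↦ hp.1⟩

/-- The second projection of a product. -/
def ssnd (V W : Type*) [AddCommGroup V] [Module ℝ V] [DiffeologicalSpace V] [DiffVectorSpace V]
    [AddCommGroup W] [Module ℝ W] [DiffeologicalSpace W] [DiffVectorSpace W] :
    Linfty (V × W) W := ⟨LinearMap.snd ℝ V W, fun _ _ hp ↦ hp.2⟩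

@[simp] theorem sinl_apply (x : V) : sinl V W x = (x, 0) := rfl
@[simp] theorem sinr_apply (x : W) : sinr V W x = (0, x) := rfl
@[simp] theorem sfst_apply (x : V × W) : sfst V W x = x.1 := rfl
@[simp] theorem ssnd_apply (x : V × W) : ssnd V W x = x.2 := rfl

theorem isShortExact_prod : IsShortExact (sinl V W).1 (ssnd V W).1 where
  injective _ _ h := congrArg Prod.fst h
  exact x := ⟨fun h ↦ ⟨x.1, Prod.ext rfl (Eq.symm h)⟩, by rintro ⟨y, rfl⟩; rfl⟩
  surjective w := ⟨(0, w), rfl⟩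
  induction := ⟨fun _ _ h ↦ congrArg Prod.fst h, fun _ _ ↦ ⟨fun hp ↦ ⟨hp, isPlot_const⟩, And.left⟩⟩
  subduction := isSubduction_of_lift (f := ssnd V W)
    fun {_ p} hp ↦ ⟨fun x ↦ (0, p x), ⟨isPlot_const, hp⟩, fun _ ↦ rfl⟩

end Basic

/-! ### Projective objects -/

theorem IsProjective.exists_lift {P X Y Z : DVect.{u}} (hP : IsProjective P) {f : Linfty X Y}
    {g : Linfty Y Z} (h : PlotExact f g) (k : Linfty P Y) (hk : ∀ x, g (k x) = 0) :
    ∃ l : Linfty P X, ∀ x, f (l x) = k x := by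
  let K : DVect.{u} := ⟨LinearMap.ker g.1⟩
  let f' : Linfty X K := ⟨f.1.codRestrict _ h.comp_apply, fun n p hp ↦ f.2 n p hp⟩
  let k' : Linfty P K := ⟨k.1.codRestrict _ hk, fun n p hp ↦ k.2 n p hp⟩
  have hf' : IsSubduction f' := isSubduction_of_lift fun {n p} hp ↦ by
    obtain ⟨q, hq, he⟩ := h.exists_lift (p := fun x ↦ (p x).1) hp fun x ↦ (p x).2
    exact ⟨q, hq, fun x ↦ Subtype.ext (he x)⟩
  obtain ⟨l, hl⟩ := hP X K f' k' hf'
  exact ⟨l, fun x ↦ congrArg Subtype.val (DFunLike.congr_fun hl x)⟩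

theorem IsProjective.exists_lift_subduction {P X Y : DVect.{u}} (hP : IsProjective P)
    {f : Linfty X Y} (hf : IsSubduction f) (k : Linfty P Y) :
    ∃ l : Linfty P X, ∀ x, f (l x) = k x := by
  obtain ⟨l, hl⟩ := hP X Y f k hf
  exact ⟨l, DFunLike.congr_fun hl⟩

theorem IsProjective.prod {P Q : DVect.{u}} (hP : IsProjective P) (hQ : IsProjective Q) :
    IsProjective ⟨P × Q⟩ := by
  intro W₁ W₂ f g hf
  obtain ⟨a, ha⟩ := hP.exists_lift_subduction hf (g ∘ₛ sinl P Q)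
  obtain ⟨b, hb⟩ := hQ.exists_lift_subduction hf (g ∘ₛ sinr P Q)
  refine ⟨a ∘ₛ sfst P Q + b ∘ₛ ssnd P Q, Linfty.ext fun x ↦ ?_⟩
  obtain ⟨x, y⟩ := x
  simp only [scomp_apply, Linfty.add_apply, map_add, ha, hb, sfst_apply, ssnd_apply, sinl_apply,
    sinr_apply]
  rw [← map_add]
  simp

/-- The index type of the basis of the free diffeological vector space on the plots of `V`: the
disjoint union of the domains of all plots of `V`. -/
abbrev PlotPoint (V : DVect.{u}) : Type u :=
  Σ (n : ℕ), {p : EuclideanSpace ℝ (Fin n) → V // IsPlot p} × EuclideanSpace ℝ (Fin n)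

/-- The basis vector of the free diffeological vector space given by a point of a plot domain. -/
def plotVec {V : DVect.{u}} {n : ℕ} (p : {p : EuclideanSpace ℝ (Fin n) → V // IsPlot p})
    (x : EuclideanSpace ℝ (Fin n)) : PlotPoint V →₀ ℝ :=
  Finsupp.single ⟨n, p, x⟩ 1

/-- A linear map on the free vector space which is smooth on each plot domain. -/
def SmoothOnPlots {V W : DVect.{u}} (g : (PlotPoint V →₀ ℝ) →ₗ[ℝ] W) : Prop :=
  ∀ (n : ℕ) (p : {p : EuclideanSpace ℝ (Fin n) → V // IsPlot p}), IsPlot fun x ↦ g (plotVec p x)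

/-- The finest vector space diffeology on the free vector space for which the inclusions of the
plot domains are smooth. -/
instance freeDiffeology (V : DVect.{u}) : DiffeologicalSpace (PlotPoint V →₀ ℝ) where
  plots _ := {r | ∀ (W : DVect.{u}) (g : (PlotPoint V →₀ ℝ) →ₗ[ℝ] W), SmoothOnPlots g →
    IsPlot (fun x ↦ g (r x))}
  constant_plots _ _ _ _ := isPlot_const
  plot_reparam hp hf W g hg := isPlot_reparam (hp W g hg) hf
  locality hp W g hg := DiffeologicalSpace.locality fun x ↦ by
    obtain ⟨s, hs, hx, h⟩ := hp x
    exact ⟨s, hs, hx, fun hf hc ↦ h hf hc W g hg⟩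

instance (V : DVect.{u}) : DiffVectorSpace (PlotPoint V →₀ ℝ) where
  dSmooth_add n p hp W g hg := by
    simpa using isPlot_add (hp.1 W g hg) (hp.2 W g hg)
  dSmooth_smul n p hp W g hg := by
    simpa using isPlot_smul hp.1 (hp.2 W g hg)

/-- The free diffeological vector space on the disjoint union of all plot domains of `V`. -/
def free (V : DVect.{u}) : DVect.{u} := ⟨PlotPoint V →₀ ℝ⟩

theorem isPlot_plotVec {V : DVect.{u}} {n : ℕ}
    (p : {p : EuclideanSpace ℝ (Fin n) → V // IsPlot p}) :
    IsPlot (X := PlotPoint V →₀ ℝ) (plotVec p) := fun _ _ hg ↦ hg n p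

/-- The universal property of the free diffeological vector space. -/
theorem exists_free_lift {V W : DVect.{u}}
    (φ : ∀ n, {p : EuclideanSpace ℝ (Fin n) → V // IsPlot p} → EuclideanSpace ℝ (Fin n) → W)
    (hφ : ∀ n p, IsPlot (φ n p)) :
    ∃ g : Linfty (PlotPoint V →₀ ℝ) W, ∀ n p x, g (plotVec p x) = φ n p x := by
  let g : (PlotPoint V →₀ ℝ) →ₗ[ℝ] W := Finsupp.linearCombination ℝ fun a ↦ φ a.1 a.2.1 a.2.2
  have hg (n p x) : g (plotVec p x) = φ n p x := by simp [g, plotVec]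
  refine ⟨⟨g, fun n p hp ↦ hp W g fun n p ↦ ?_⟩, hg⟩
  simpa only [hg] using hφ n p

theorem isProjective_free (V : DVect.{u}) : IsProjective (free V) := by
  intro W₁ W₂ f (g : Linfty (PlotPoint V →₀ ℝ) W₂) hf
  have h (n) (p : {p : EuclideanSpace ℝ (Fin n) → V // IsPlot p}) :=
    IsSubduction.exists_lift (f := f.1) hf (isPlot_map g (isPlot_plotVec p))
  choose φ hφ he using h
  obtain ⟨k, hk⟩ := exists_free_lift φ hφ
  refine ⟨k, Subtype.ext (Finsupp.lhom_ext' fun a ↦ LinearMap.ext_ring ?_)⟩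
  exact (congrArg f (hk a.1 a.2.1 a.2.2)).trans (he _ _ _)

/-- There are enough projectives. -/
theorem exists_projective_cover (V : DVect.{u}) :
    ∃ (P : DVect.{u}) (f : Linfty P V), IsProjective P ∧ IsSubduction f := by
  obtain ⟨f, hf⟩ := exists_free_lift (V := V) (W := V) (fun _ p ↦ p.1) fun _ p ↦ p.2
  exact ⟨free V, f, isProjective_free V, isSubduction_of_lift (f := f)
    fun {n p} hp ↦ ⟨plotVec ⟨p, hp⟩, isPlot_plotVec ⟨p, hp⟩, fun x ↦ hf n ⟨p, hp⟩ x⟩⟩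

/-! ### Projective resolutions -/

theorem ProjRes.plotExact_zero {V : DVect.{u}} (P : ProjRes V) : PlotExact (P.d 0) P.ε :=
  P.exact_zero.plotExact

theorem ProjRes.plotExact_succ {V : DVect.{u}} (P : ProjRes V) (n : ℕ) :
    PlotExact (P.d (n + 1)) (P.d n) :=
  (P.exact_succ n).plotExact

@[simp]
theorem ProjRes.d_d_apply {V : DVect.{u}} (P : ProjRes V) (n : ℕ) (x : P.X (n + 2)) :
    P.d n (P.d (n + 1) x) = 0 := (P.plotExact_succ n).comp_apply x

@[simp]
theorem ProjRes.ε_d_apply {V : DVect.{u}} (P : ProjRes V) (x : P.X 1) :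
    P.ε (P.d 0 x) = 0 := P.plotExact_zero.comp_apply x

/-- A complex of projectives over `V` that is exact on plots is a projective resolution. -/
def ProjRes.ofPlotExact {V : DVect.{u}} (X : ℕ → DVect.{u}) (d : ∀ n, Linfty (X (n + 1)) (X n))
    (ε : Linfty (X 0) V) (hX : ∀ n, IsProjective (X n)) (hε : IsSubduction ε)
    (h0 : PlotExact (d 0) ε) (hd : ∀ n, PlotExact (d (n + 1)) (d n)) : ProjRes V where
  X := X
  d := d
  ε := ε
  projective := hX
  subduction_ε := hε
  exact_zero := h0.isExactAt fun hp _ ↦ IsSubduction.exists_lift (f := ε.1) hε hp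
  exact_succ n := (hd n).isExactAt fun {_ p} hp h ↦ by
    cases n with
    | zero =>
      refine h0.exists_lift hp fun x ↦ ?_
      obtain ⟨y, hy⟩ := h x
      rw [← hy, h0.comp_apply]
    | succ n =>
      refine (hd n).exists_lift hp fun x ↦ ?_
      obtain ⟨y, hy⟩ := h x
      rw [← hy, (hd n).comp_apply]

/-- The kernel of a smooth linear map, as a diffeological vector space. -/
abbrev kerObj {X Y : DVect.{u}} (f : Linfty X Y) : DVect.{u} := ⟨LinearMap.ker f.1⟩

/-- A smooth linear map between diffeological vector spaces, bundled with its ends. -/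
structure Arrow where
  /-- the source -/
  X : DVect.{u}
  /-- the target -/
  Y : DVect.{u}
  /-- the map -/
  f : Linfty X Y

/-- A projective diffeological vector space with a subduction onto `V`. -/
def cover (V : DVect.{u}) : DVect.{u} := (exists_projective_cover V).choose

/-- The subduction from the projective cover. -/
def coverMap (V : DVect.{u}) : Linfty (cover V) V := (exists_projective_cover V).choose_spec.choose

theorem isProjective_cover (V : DVect.{u}) : IsProjective (cover V) :=
  (exists_projective_cover V).choose_spec.choose_spec.1

theorem isSubduction_coverMap (V : DVect.{u}) : IsSubduction (coverMap V) :=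
  (exists_projective_cover V).choose_spec.choose_spec.2

/-- The boundary maps of a resolution by successive projective covers of kernels. -/
def resArrow (V : DVect.{u}) : ℕ → Arrow.{u}
  | 0 => ⟨cover V, V, coverMap V⟩
  | n + 1 => ⟨cover (kerObj (resArrow V n).f), (resArrow V n).X,
      ⟨(LinearMap.ker (resArrow V n).f.1).subtype ∘ₗ (coverMap (kerObj (resArrow V n).f)).1,
        (coverMap (kerObj (resArrow V n).f)).2⟩⟩

theorem isProjective_resArrow (V : DVect.{u}) (n : ℕ) : IsProjective (resArrow V n).X := by
  cases n <;> exact isProjective_cover _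

theorem plotExact_coverMap {X Y : DVect.{u}} (f : Linfty X Y) :
    PlotExact (V := cover (kerObj f)) ⟨(LinearMap.ker f.1).subtype ∘ₗ (coverMap (kerObj f)).1,
        (coverMap (kerObj f)).2⟩ f := by
  refine ⟨fun x ↦ (coverMap (kerObj f) x).2, fun {n p} hp h ↦ ?_⟩
  obtain ⟨q, hq, he⟩ := IsSubduction.exists_lift (f := (coverMap (kerObj f)).1)
    (isSubduction_coverMap _) (p := fun x ↦ (⟨p x, h x⟩ : LinearMap.ker f.1)) hp
  exact ⟨q, hq, fun x ↦ congrArg Subtype.val (he x)⟩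

/-- Every diffeological vector space has a diffeological projective resolution. -/
theorem nonempty_projRes (V : DVect.{u}) : Nonempty (ProjRes V) :=
  ⟨ProjRes.ofPlotExact (fun n ↦ (resArrow V n).X) (fun n ↦ (resArrow V (n + 1)).f)
    (resArrow V 0).f (isProjective_resArrow V) (isSubduction_coverMap V)
    (plotExact_coverMap (resArrow V 0).f) fun n ↦ plotExact_coverMap (resArrow V (n + 1)).f⟩

/-! ### The comparison theorem -/

section Comparison

variable {V : DVect.{u}} (X : ℕ → DVect.{u}) (dX : ∀ n, Linfty (X (n + 1)) (X n)) (Q : ProjRes V)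

/-- A map from a complex of projectives to a resolution can be lifted to a chain map. -/
theorem exists_chain_lift (hX : ∀ n, IsProjective (X n)) (hd : ∀ n x, dX n (dX (n + 1) x) = 0)
    (g : Linfty (X 0) V) (hg : ∀ x, g (dX 0 x) = 0) :
    ∃ t : ∀ n, Linfty (X n) (Q.X n), (∀ x, Q.ε (t 0 x) = g x) ∧
      ∀ n x, Q.d n (t (n + 1) x) = t n (dX n x) := by
  obtain ⟨a, ha⟩ := (hX 0).exists_lift_subduction Q.subduction_ε g
  obtain ⟨b, hb⟩ := (hX 1).exists_lift Q.plotExact_zero (a ∘ₛ dX 0)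
    fun x ↦ (ha _).trans (hg x)
  let S (n : ℕ) := {p : Linfty (X n) (Q.X n) × Linfty (X (n + 1)) (Q.X (n + 1)) //
    ∀ x, Q.d n (p.2 x) = p.1 (dX n x)}
  have hstep (n) (p : S n) : ∃ c : Linfty (X (n + 2)) (Q.X (n + 2)),
      ∀ x, Q.d (n + 1) (c x) = p.1.2 (dX (n + 1) x) :=
    (hX (n + 2)).exists_lift (Q.plotExact_succ n) (p.1.2 ∘ₛ dX (n + 1)) fun x ↦ by
      rw [scomp_apply, p.2, hd, map_zero]
  choose c hc using hstep
  let s : ∀ n, S n := fun n ↦ Nat.rec ⟨(a, b), hb⟩ (fun n p ↦ ⟨(p.1.2, c n p), hc n p⟩) n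
  exact ⟨fun n ↦ (s n).1.1, ha, fun n ↦ (s n).2⟩

/-- A chain map `t` from a complex of projectives to a resolution that agrees, on the augmentation,
with a map `v` vanishing on boundaries, is homotopic to `v`. -/
theorem exists_homotopy (hX : ∀ n, IsProjective (X n)) (hd : ∀ n x, dX n (dX (n + 1) x) = 0)
    (t : ∀ n, Linfty (X n) (Q.X n)) (ht : ∀ n x, Q.d n (t (n + 1) x) = t n (dX n x))
    (v : Linfty (X 0) (Q.X 0)) (hv : ∀ x, v (dX 0 x) = 0) (h0 : ∀ x, Q.ε (t 0 x) = Q.ε (v x)) :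
    (∃ k : Linfty (X 0) (Q.X 1), ∀ x, t 0 x = v x + Q.d 0 (k x)) ∧
      ∀ n, ∃ (h : Linfty (X n) (Q.X (n + 1))) (k : Linfty (X (n + 1)) (Q.X (n + 2))),
        ∀ x, t (n + 1) x = h (dX n x) + Q.d (n + 1) (k x) := by
  have hstep (n) (w : Linfty (X n) (Q.X n)) (k : Linfty (X n) (Q.X (n + 1)))
      (hw : ∀ x, w (dX n x) = 0) (hk : ∀ x, t n x = w x + Q.d n (k x)) :
      ∃ k' : Linfty (X (n + 1)) (Q.X (n + 2)),
        ∀ x, t (n + 1) x = k (dX n x) + Q.d (n + 1) (k' x) := by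
    obtain ⟨k', hk'⟩ := (hX (n + 1)).exists_lift (Q.plotExact_succ n) (t (n + 1) - k ∘ₛ dX n)
      fun x ↦ by simp [map_sub, ht, hk, hw]
    exact ⟨k', fun x ↦ by rw [hk']; simp⟩
  obtain ⟨k₀, hk₀⟩ := (hX 0).exists_lift Q.plotExact_zero (t 0 - v) fun x ↦ by
    simp [map_sub, h0]
  have hk₀' (x) : t 0 x = v x + Q.d 0 (k₀ x) := by rw [hk₀]; simp
  refine ⟨⟨k₀, hk₀'⟩, fun n ↦ ?_⟩
  induction n with
  | zero => exact ⟨k₀, hstep 0 v k₀ hv hk₀'⟩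
  | succ n ih =>
    obtain ⟨h, k, hk⟩ := ih
    exact ⟨k, hstep (n + 1) (h ∘ₛ dX n) k (fun x ↦ by simp [hd]) hk⟩

end Comparison

/-! ### Cohomology classes -/

namespace DCochain

/-- Coboundaries in degree `n`, as a predicate on cochains. -/
def IsCob (C : DCochain.{u}) : ∀ n : ℕ, C.X n → Prop
  | 0, x => x = 0
  | n + 1, x => ∃ y : C.X n, C.d n y = x

variable {C D : DCochain.{u}}

theorem mem_coboundaries {n : ℕ} (x : C.cocycles n) : x ∈ C.coboundaries n ↔ C.IsCob n x.1 := by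
  cases n with
  | zero => exact (Submodule.mem_bot ℝ).trans Subtype.ext_iff
  | succ n => exact Iff.rfl

theorem d_d_apply (n : ℕ) (x : C.X n) : C.d (n + 1) (C.d n x) = 0 :=
  DFunLike.congr_fun (C.d_comp_d n) x

theorem isSubduction_cls (n : ℕ) : IsSubduction (C.cls n) := isSubduction_mkQ _

theorem cls_surjective (n : ℕ) (x : C.H n) : ∃ a, C.cls n a = x := (isSubduction_cls n).1 x

theorem cls_eq_cls {n : ℕ} {a b : C.cocycles n} :
    C.cls n a = C.cls n b ↔ C.IsCob n (a.1 - b.1) :=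
  (Submodule.Quotient.eq _).trans (mem_coboundaries (a - b))

theorem cls_eq_zero {n : ℕ} {a : C.cocycles n} : C.cls n a = 0 ↔ C.IsCob n a.1 :=
  (Submodule.Quotient.mk_eq_zero _).trans (mem_coboundaries a)

/-- A smooth linear map between terms of cochain complexes that preserves cocycles and coboundaries
induces a smooth linear map on cohomology. -/
theorem exists_cohMap {m n : ℕ} (f : Linfty (C.X m) (D.X n))
    (h : ∀ a, C.d m a = 0 → D.d n (f a) = 0) (h' : ∀ a, C.IsCob m a → D.IsCob n (f a)) :
    ∃ φ : Linfty (C.H m) (D.H n), ∀ (a : C.cocycles m),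
      φ (C.cls m a) = D.cls n ⟨f a.1, h a.1 a.2⟩ := by
  let g : Linfty (C.cocycles m) (D.cocycles n) :=
    ⟨f.1.restrict fun x hx ↦ h x hx, fun n p hp ↦ f.2 n _ hp⟩
  obtain ⟨φ, hφ⟩ := (isSubduction_cls m).exists_factor (D.cls n ∘ₛ g) fun a ha ↦
    cls_eq_zero.mpr (h' _ (cls_eq_zero.mp ha))
  exact ⟨φ, fun a ↦ DFunLike.congr_fun hφ a⟩

end DCochain

/-! ### Functoriality of Ext -/

section Functoriality

variable {V V' V'' : DVect.{u}} {P : ProjRes V} {Q : ProjRes V'} {R : ProjRes V''}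
  {f : Linfty V V'} {g : Linfty V' V''}

theorem ProjRes.Lift.ε_apply (F : ProjRes.Lift f P Q) (x : P.X 0) :
    Q.ε (F.hom 0 x) = f (P.ε x) := DFunLike.congr_fun F.comm_ε x

theorem ProjRes.Lift.d_apply (F : ProjRes.Lift f P Q) (n : ℕ) (x : P.X (n + 1)) :
    Q.d n (F.hom (n + 1) x) = F.hom n (P.d n x) := DFunLike.congr_fun (F.comm_d n) x

theorem ProjRes.nonempty_lift (f : Linfty V V') (P : ProjRes V) (Q : ProjRes V') :
    Nonempty (ProjRes.Lift f P Q) := by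
  obtain ⟨t, h0, ht⟩ := exists_chain_lift P.X P.d Q P.projective (fun n x ↦ P.d_d_apply n x)
    (f ∘ₛ P.ε) fun x ↦ by simp
  exact ⟨⟨t, Linfty.ext h0, fun n ↦ Linfty.ext (ht n)⟩⟩

theorem ProjRes.cocycle_apply (P : ProjRes V) {W : DVect.{u}} {n : ℕ}
    {a : Linfty (P.X n) W} (ha : (P.homComplex W).d n a = 0) (x : P.X (n + 1)) : a (P.d n x) = 0 :=
  DFunLike.congr_fun ha x

/-- Chain maps extending the same smooth linear map induce the same map on Ext. -/
theorem ProjRes.Lift.extMap_eq (F G : ProjRes.Lift f P Q) (W : DVect.{u}) (n : ℕ) :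
    F.extMap W n = G.extMap W n := by
  obtain ⟨⟨k, hk⟩, hn⟩ := exists_homotopy P.X P.d Q P.projective (fun n x ↦ P.d_d_apply n x)
    (fun n ↦ F.hom n - G.hom n)
    (fun n x ↦ by simp [map_sub, F.d_apply, G.d_apply]) 0 (fun _ ↦ rfl)
    (fun x ↦ by simp [map_sub, F.ε_apply, G.ε_apply])
  refine Linfty.ext fun c ↦ ?_
  obtain ⟨⟨a, ha⟩, rfl⟩ := DCochain.cls_surjective n c
  refine DCochain.cls_eq_cls.mpr ?_
  change Linfty (Q.X n) W at a
  have had := Q.cocycle_apply ha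
  cases n with
  | zero =>
    refine Linfty.ext fun x ↦ ?_
    change a (F.hom 0 x) - a (G.hom 0 x) = 0
    rw [← map_sub, ← Linfty.sub_apply, hk]
    simp [had]
  | succ n =>
    obtain ⟨h, k, hk⟩ := hn n
    refine ⟨a ∘ₛ h, Linfty.ext fun x ↦ ?_⟩
    change a (h (P.d n x)) = a (F.hom (n + 1) x) - a (G.hom (n + 1) x)
    rw [← map_sub, ← Linfty.sub_apply, hk, map_add, had, add_zero]

/-- Composition of chain maps. -/
def ProjRes.Lift.comp (G : ProjRes.Lift g Q R) (F : ProjRes.Lift f P Q) :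
    ProjRes.Lift (g ∘ₛ f) P R where
  hom n := G.hom n ∘ₛ F.hom n
  comm_ε := Linfty.ext fun x ↦ by simp [F.ε_apply, G.ε_apply]
  comm_d n := Linfty.ext fun x ↦ by simp [F.d_apply, G.d_apply]

theorem ProjRes.Lift.extMap_comp (G : ProjRes.Lift g Q R) (F : ProjRes.Lift f P Q) (W : DVect.{u})
    (n : ℕ) (x : Ext R W n) : (G.comp F).extMap W n x = F.extMap W n (G.extMap W n x) := by
  obtain ⟨a, rfl⟩ := DCochain.cls_surjective n x
  rfl

/-- The identity chain map. -/
def ProjRes.Lift.id (P : ProjRes V) : ProjRes.Lift (sid V) P P where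
  hom n := sid (P.X n)
  comm_ε := rfl
  comm_d _ := rfl

theorem ProjRes.Lift.extMap_id (W : DVect.{u}) (n : ℕ) (x : Ext P W n) :
    (ProjRes.Lift.id P).extMap W n x = x := by
  obtain ⟨a, rfl⟩ := DCochain.cls_surjective n x
  rfl

theorem ProjRes.Lift.extMap_bijective {P P' : ProjRes V} (A : ProjRes.Lift (sid V) P P')
    (W : DVect.{u}) (n : ℕ) : Function.Bijective (A.extMap W n) := by
  obtain ⟨B⟩ := ProjRes.nonempty_lift (sid V) P' P
  refine Function.bijective_iff_has_inverse.mpr ⟨B.extMap W n, fun x ↦ ?_, fun x ↦ ?_⟩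
  · rw [← extMap_comp]
    exact (DFunLike.congr_fun (extMap_eq (f := sid V) (A.comp B) (.id P') W n) x).trans
      (extMap_id W n x)
  · rw [← extMap_comp]
    exact (DFunLike.congr_fun (extMap_eq (f := sid V) (B.comp A) (.id P) W n) x).trans
      (extMap_id W n x)

end Functoriality

/-! ### The long exact sequence of a short exact sequence of cochain complexes -/

namespace DCochain

variable {C₁ C₂ C₃ : DCochain.{u}} {F : Hom C₃ C₂} {G : Hom C₂ C₁}

theorem exact_map_map (hF : ∀ n, Function.Injective (F.f n))
    (hFG : ∀ n, Function.Exact (F.f n) (G.f n)) (hG : ∀ n, Function.Surjective (G.f n)) (n : ℕ) :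
    Function.Exact (F.map (n + 1)) (G.map (n + 1)) := by
  intro x
  constructor
  · intro hx
    obtain ⟨⟨b, hb⟩, rfl⟩ := cls_surjective (n + 1) x
    obtain ⟨a', ha' : C₁.d n a' = G.f (n + 1) b⟩ := cls_eq_zero.mp hx
    obtain ⟨b', rfl⟩ := hG n a'
    obtain ⟨c, hc⟩ := (hFG (n + 1) (b - C₂.d n b')).mp (by
      rw [map_sub, ← ha', G.comm_apply, sub_self])
    have hdc : C₃.d (n + 1) c = 0 := hF (n + 2) (by
      rw [← F.comm_apply, hc, map_sub, d_d_apply, map_zero, sub_zero]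
      exact hb)
    refine ⟨C₃.cls (n + 1) ⟨c, hdc⟩, cls_eq_cls.mpr ⟨-b', ?_⟩⟩
    change _ = F.f (n + 1) c - b
    rw [hc, map_neg]
    abel
  · rintro ⟨y, rfl⟩
    obtain ⟨⟨c, hc⟩, rfl⟩ := cls_surjective (n + 1) y
    refine cls_eq_zero.mpr ⟨0, ?_⟩
    change _ = G.f (n + 1) (F.f (n + 1) c)
    rw [(hFG (n + 1) _).mpr ⟨c, rfl⟩, map_zero]

variable {n : ℕ} {δ : Linfty (C₁.H n) (C₃.H (n + 1))}

theorem exact_map_connecting (hF : ∀ n, Function.Injective (F.f n))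
    (hFG : ∀ n, Function.Exact (F.f n) (G.f n)) (hG : ∀ n, Function.Surjective (G.f n))
    (hδ : ∀ (a : C₁.cocycles n) (b : C₂.X n) (c : C₃.cocycles (n + 1)), G.f n b = a.1 →
      C₂.d n b = F.f (n + 1) c.1 → δ (C₁.cls n a) = C₃.cls (n + 1) c) :
    Function.Exact (G.map n) δ := by
  intro x
  constructor
  · intro hx
    obtain ⟨⟨a, ha⟩, rfl⟩ := cls_surjective n x
    obtain ⟨b, rfl⟩ := hG n a
    obtain ⟨c, hc⟩ := (hFG (n + 1) (C₂.d n b)).mp (by rw [← G.comm_apply]; exact ha)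
    have hdc : C₃.d (n + 1) c = 0 := hF (n + 2) (by
      rw [← F.comm_apply, hc, d_d_apply, map_zero])
    rw [hδ _ b ⟨c, hdc⟩ rfl hc.symm] at hx
    obtain ⟨c', rfl : C₃.d n c' = c⟩ := cls_eq_zero.mp hx
    have hb : C₂.d n (b - F.f n c') = 0 := by rw [map_sub, ← hc, F.comm_apply, sub_self]
    refine ⟨C₂.cls n ⟨_, hb⟩, congrArg (C₁.cls n) (Subtype.ext ?_)⟩
    change G.f n (b - F.f n c') = G.f n b
    rw [map_sub, (hFG n _).mpr ⟨c', rfl⟩, sub_zero]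
  · rintro ⟨y, rfl⟩
    obtain ⟨⟨b, hb⟩, rfl⟩ := cls_surjective n y
    refine (hδ (G.cocycleMap n ⟨b, hb⟩) b 0 rfl ?_).trans (map_zero _)
    rw [show C₂.d n b = 0 from hb]
    exact (map_zero (F.f (n + 1))).symm

theorem exact_connecting_map
    (hFG : ∀ n, Function.Exact (F.f n) (G.f n)) (hG : ∀ n, Function.Surjective (G.f n))
    (hF : ∀ n, Function.Injective (F.f n))
    (hδ : ∀ (a : C₁.cocycles n) (b : C₂.X n) (c : C₃.cocycles (n + 1)), G.f n b = a.1 →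
      C₂.d n b = F.f (n + 1) c.1 → δ (C₁.cls n a) = C₃.cls (n + 1) c) :
    Function.Exact δ (F.map (n + 1)) := by
  intro x
  constructor
  · intro hx
    obtain ⟨⟨c, hc⟩, rfl⟩ := cls_surjective (n + 1) x
    obtain ⟨b, hb : C₂.d n b = F.f (n + 1) c⟩ := cls_eq_zero.mp hx
    have ha : C₁.d n (G.f n b) = 0 := by
      rw [G.comm_apply, hb]
      exact (hFG (n + 1) _).mpr ⟨c, rfl⟩
    exact ⟨C₁.cls n ⟨_, ha⟩, hδ ⟨_, ha⟩ b ⟨c, hc⟩ rfl hb⟩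
  · rintro ⟨y, rfl⟩
    obtain ⟨⟨a, ha⟩, rfl⟩ := cls_surjective n y
    obtain ⟨b, rfl⟩ := hG n a
    obtain ⟨c, hc⟩ := (hFG (n + 1) (C₂.d n b)).mp (by rw [← G.comm_apply]; exact ha)
    have hdc : C₃.d (n + 1) c = 0 := hF (n + 2) (by
      rw [← F.comm_apply, hc, d_d_apply, map_zero])
    rw [hδ _ b ⟨c, hdc⟩ rfl hc.symm]
    exact cls_eq_zero.mpr ⟨b, hc.symm⟩

end DCochain

/-! ### The twisting maps of an extension -/

section Connecting

variable {V₁ V₂ V₃ : DVect.{u}}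

/-- Twisting maps `θₙ : P³ₙ₊₁ → P¹ₙ` of an extension of `V₃` by `V₁`: these are the off-diagonal
entries of the boundary maps, and `σ` that of the augmentation, of a resolution of `V₂` with terms
`P¹ₙ × P³ₙ`. -/
structure Twist (i : Linfty V₁ V₂) (π : Linfty V₂ V₃) (P₁ : ProjRes V₁) (P₃ : ProjRes V₃) where
  /-- a lift of the augmentation to `V₂` -/
  σ : Linfty (P₃.X 0) V₂
  /-- the twisting maps -/
  θ : ∀ n, Linfty (P₃.X (n + 1)) (P₁.X n)
  π_σ : ∀ x, π (σ x) = P₃.ε x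
  ε_θ : ∀ x, i (P₁.ε (θ 0 x)) = -σ (P₃.d 0 x)
  d_θ : ∀ n x, P₁.d n (θ (n + 1) x) = -θ n (P₃.d (n + 1) x)

variable {i : Linfty V₁ V₂} {π : Linfty V₂ V₃} {P₁ : ProjRes V₁} {P₃ : ProjRes V₃}

theorem nonempty_twist (hex : IsShortExact i.1 π.1) (P₁ : ProjRes V₁) (P₃ : ProjRes V₃) :
    Nonempty (Twist i π P₁ P₃) := by
  obtain ⟨σ, hσ⟩ := (P₃.projective 0).exists_lift_subduction hex.subduction P₃.ε
  obtain ⟨τ, hτ⟩ := hex.exists_factor (-(σ ∘ₛ P₃.d 0)) fun x ↦ by simp [map_neg, hσ]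
  have hτ' (x) : i (τ x) = -σ (P₃.d 0 x) := DFunLike.congr_fun hτ x
  obtain ⟨t, h0, ht⟩ := exists_chain_lift (fun n ↦ P₃.X (n + 1)) (fun n ↦ -P₃.d (n + 1)) P₁
    (fun n ↦ P₃.projective (n + 1)) (fun n x ↦ by simp) τ fun x ↦ hex.injective (by
      simp [map_neg, hτ'])
  exact ⟨⟨σ, t, hσ, fun x ↦ by rw [h0, hτ'], fun n x ↦ by simp [ht]⟩⟩

namespace Twist

variable {W : DVect.{u}}

theorem comp_θ_cocycle (T : Twist i π P₁ P₃) {n : ℕ} {a : Linfty (P₁.X n) W}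
    (ha : ∀ x, a (P₁.d n x) = 0) : (P₃.homComplex W).d (n + 1) (a ∘ₛ T.θ n) = 0 :=
  Linfty.ext fun x ↦ by
    change a (T.θ n (P₃.d (n + 1) x)) = 0
    rw [← neg_eq_zero, ← map_neg, ← T.d_θ, ha]

/-- The connecting map `[a] ↦ [a ∘ θₙ]` of a twist. -/
theorem exists_connecting (T : Twist i π P₁ P₃) (W : DVect.{u}) (n : ℕ) :
    ∃ δ : Linfty (Ext P₁ W n) (Ext P₃ W (n + 1)), ∀ a : (P₁.homComplex W).cocycles n,
      δ ((P₁.homComplex W).cls n a) = (P₃.homComplex W).cls (n + 1)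
        ⟨scomp (V' := P₁.X n) a.1 (T.θ n), T.comp_θ_cocycle (P₁.cocycle_apply a.2)⟩ := by
  refine DCochain.exists_cohMap (C := P₁.homComplex W) (D := P₃.homComplex W) (precomp W (T.θ n))
    (fun a ha ↦ T.comp_θ_cocycle (P₁.cocycle_apply ha)) fun a ha ↦ ?_
  cases n with
  | zero => exact ⟨0, by rw [show a = 0 from ha, map_zero, map_zero]⟩
  | succ n =>
    obtain ⟨b, rfl⟩ := ha
    change Linfty (P₁.X n) W at b
    refine ⟨-(b ∘ₛ T.θ n), Linfty.ext fun x ↦ ?_⟩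
    change -b (T.θ n (P₃.d (n + 1) x)) = b (P₁.d n (T.θ (n + 1) x))
    rw [T.d_θ, map_neg]

/-- Different twists give the same connecting map. -/
theorem isCob_sub (hex : IsShortExact i.1 π.1) (T T' : Twist i π P₁ P₃) {n : ℕ}
    {a : Linfty (P₁.X n) W} (ha : ∀ x, a (P₁.d n x) = 0) :
    (P₃.homComplex W).IsCob (n + 1) (a ∘ₛ T.θ n - a ∘ₛ T'.θ n) := by
  obtain ⟨ρ, hρ⟩ := hex.exists_factor (T'.σ - T.σ) fun x ↦ by simp [map_sub, T.π_σ, T'.π_σ]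
  obtain ⟨r, hr⟩ := (P₃.projective 0).exists_lift_subduction P₁.subduction_ε ρ
  have hρ' (x) : i (ρ x) = T'.σ x - T.σ x := DFunLike.congr_fun hρ x
  obtain ⟨⟨k, hk⟩, hn⟩ := exists_homotopy (fun n ↦ P₃.X (n + 1)) (fun n ↦ -P₃.d (n + 1)) P₁
    (fun n ↦ P₃.projective (n + 1)) (fun n x ↦ by simp)
    (fun n ↦ T.θ n - T'.θ n)
    (fun n x ↦ by simp [map_sub, T.d_θ, T'.d_θ]) (r ∘ₛ P₃.d 0)
    (fun x ↦ by simp) (fun x ↦ hex.injective (by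
      simp only [coe_val_apply, Linfty.sub_apply, scomp_apply, map_sub, T.ε_θ, T'.ε_θ, hr, hρ']
      abel))
  cases n with
  | zero =>
    refine ⟨a ∘ₛ r, Linfty.ext fun x ↦ ?_⟩
    change a (r (P₃.d 0 x)) = a (T.θ 0 x) - a (T'.θ 0 x)
    rw [← map_sub, ← Linfty.sub_apply, hk, map_add, ha, add_zero, scomp_apply]
  | succ n =>
    obtain ⟨h, k, hk⟩ := hn n
    refine ⟨-(a ∘ₛ h), Linfty.ext fun x ↦ ?_⟩
    change -a (h (P₃.d (n + 1) x)) = a (T.θ (n + 1) x) - a (T'.θ (n + 1) x)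
    rw [← map_sub, ← Linfty.sub_apply, hk, map_add, ha, add_zero, Linfty.neg_apply, map_neg,
      map_neg]

/-- In a degreewise short exact sequence of resolutions, `[a] ↦ [a ∘ θₙ]` is the connecting map. -/
theorem isCob_of_shortExact (hex : IsShortExact i.1 π.1) (T : Twist i π P₁ P₃) {P₂ : ProjRes V₂}
    (I : ProjRes.Lift i P₁ P₂) (J : ProjRes.Lift π P₂ P₃)
    (hIJ : ∀ n, IsShortExact (I.hom n).1 (J.hom n).1) {n : ℕ} {a : Linfty (P₁.X n) W}
    (ha : ∀ x, a (P₁.d n x) = 0) {b : Linfty (P₂.X n) W} {c : Linfty (P₃.X (n + 1)) W}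
    (hab : ∀ x, b (I.hom n x) = a x) (hbc : ∀ x, b (P₂.d n x) = c (J.hom (n + 1) x)) :
    (P₃.homComplex W).IsCob (n + 1) (a ∘ₛ T.θ n - c) := by
  have hs (n) := (P₃.projective n).exists_lift_subduction (hIJ n).subduction (sid (P₃.X n))
  choose s hs using hs
  have hs' (n x) : J.hom n (s n x) = x := hs n x
  have hθ (n) := (hIJ n).exists_factor (P₂.d n ∘ₛ s (n + 1) - s n ∘ₛ P₃.d n) fun x ↦ by
    simp only [Linfty.sub_apply, scomp_apply, map_sub, ← J.d_apply, hs', sub_self]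
  choose θ hθ using hθ
  have hθ' (n x) : I.hom n (θ n x) = P₂.d n (s (n + 1) x) - s n (P₃.d n x) :=
    DFunLike.congr_fun (hθ n) x
  let T' : Twist i π P₁ P₃ :=
    { σ := P₂.ε ∘ₛ s 0
      θ := θ
      π_σ := fun x ↦ by rw [scomp_apply, ← J.ε_apply, hs']
      ε_θ := fun x ↦ by rw [← I.ε_apply, hθ', map_sub, P₂.ε_d_apply, zero_sub, scomp_apply]
      d_θ := fun n x ↦ (hIJ n).injective (by
        simp only [coe_val_apply]
        rw [← I.d_apply, hθ', map_neg, hθ', map_sub, P₂.d_d_apply, P₃.d_d_apply, map_zero]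
        abel) }
  obtain ⟨y, hy⟩ := T.isCob_sub hex T' ha
  change Linfty (P₃.X n) W at y
  have hy' (x) : y (P₃.d n x) = a (T.θ n x) - a (θ n x) := DFunLike.congr_fun hy x
  refine ⟨y - b ∘ₛ s n, Linfty.ext fun x ↦ ?_⟩
  change y (P₃.d n x) - b (s n (P₃.d n x)) = a (T.θ n x) - c x
  rw [hy', ← hab (θ n x), hθ', map_sub, hbc, hs']
  abel

/-- The resolution of the middle term of an extension with terms `P¹ₙ × P³ₙ`. -/
theorem exists_horseshoe (hex : IsShortExact i.1 π.1) (T : Twist i π P₁ P₃) :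
    ∃ (P₂ : ProjRes V₂) (I : ProjRes.Lift i P₁ P₂) (J : ProjRes.Lift π P₂ P₃),
      (∀ n, IsShortExact (I.hom n).1 (J.hom n).1) ∧
      ∀ n, ∃ r : Linfty (P₂.X n) (P₁.X n), ∀ x, r (I.hom n x) = x := by
  let d (n : ℕ) : Linfty (P₁.X (n + 1) × P₃.X (n + 1)) (P₁.X n × P₃.X n) :=
    sinl _ _ ∘ₛ (P₁.d n ∘ₛ sfst _ _ + T.θ n ∘ₛ ssnd _ _) + sinr _ _ ∘ₛ P₃.d n ∘ₛ ssnd _ _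
  let ε : Linfty (P₁.X 0 × P₃.X 0) V₂ := i ∘ₛ P₁.ε ∘ₛ sfst _ _ + T.σ ∘ₛ ssnd _ _
  have hd (n) (x) : d n x = (P₁.d n x.1 + T.θ n x.2, P₃.d n x.2) := by simp [d]
  have hε (x) : ε x = i (P₁.ε x.1) + T.σ x.2 := rfl
  have hi : ∀ a b, i a = i b → a = b := fun a b h ↦ hex.injective h
  have hsub : IsSubduction ε := isSubduction_of_lift fun {n p} hp ↦ by
    obtain ⟨y, hy, hy'⟩ := IsSubduction.exists_lift (f := P₃.ε.1) P₃.subduction_ε (isPlot_map π hp)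
    have hz (x) : ∃ z, i z = p x - T.σ (y x) := (hex.exact _).mp (by
      simp only [coe_val_apply] at hy' ⊢
      rw [map_sub, T.π_σ, hy', sub_self])
    choose z hz using hz
    have hzp : IsPlot z := (hex.induction.2 n z).mpr (by
      have : IsPlot fun x ↦ i (z x) := by
        simpa only [hz] using isPlot_sub hp (isPlot_map T.σ hy)
      exact this)
    obtain ⟨w, hw, hw'⟩ := IsSubduction.exists_lift (f := P₁.ε.1) P₁.subduction_ε hzp
    refine ⟨fun x ↦ (w x, y x), ⟨hw, hy⟩, fun x ↦ ?_⟩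
    rw [hε, show P₁.ε (w x) = z x from hw' x, hz, sub_add_cancel]
  have h0 : PlotExact (d 0) ε := by
    refine ⟨fun x ↦ ?_, fun {n p} hp h ↦ ?_⟩
    · simp only [hε, hd, map_add, P₁.ε_d_apply, map_zero, T.ε_θ]
      abel
    · obtain ⟨y, hy, hy'⟩ := P₃.plotExact_zero.exists_lift hp.2 fun x ↦ by
        have := congrArg π (h x)
        rwa [hε, map_add, show π (i _) = 0 from hex.comp_apply _, T.π_σ, zero_add,
          map_zero] at this
      obtain ⟨z, hz, hz'⟩ := P₁.plotExact_zero.exists_lift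
        (isPlot_sub hp.1 (isPlot_map (T.θ 0) hy)) fun x ↦ hi _ _ (by
          rw [map_sub, map_sub, T.ε_θ, hy', sub_neg_eq_add, map_zero]
          exact h x)
      exact ⟨fun x ↦ (z x, y x), ⟨hz, hy⟩, fun x ↦ by
        rw [hd]; exact Prod.ext (by simp [hz']) (hy' x)⟩
  have hs (m) : PlotExact (d (m + 1)) (d m) := by
    refine ⟨fun x ↦ ?_, fun {n p} hp h ↦ ?_⟩
    · simp only [hd, map_add, P₁.d_d_apply, P₃.d_d_apply, T.d_θ]
      exact Prod.ext (by simp) rfl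
    · have h' (x) := Prod.ext_iff.mp ((hd m (p x)).symm.trans (h x))
      obtain ⟨y, hy, hy'⟩ := (P₃.plotExact_succ m).exists_lift hp.2 fun x ↦ (h' x).2
      obtain ⟨z, hz, hz'⟩ := (P₁.plotExact_succ m).exists_lift
        (isPlot_sub hp.1 (isPlot_map (T.θ (m + 1)) hy)) fun x ↦ by
          rw [map_sub, T.d_θ, hy', sub_neg_eq_add]
          exact (h' x).1
      exact ⟨fun x ↦ (z x, y x), ⟨hz, hy⟩, fun x ↦ by
        rw [hd]; exact Prod.ext (by simp [hz']) (hy' x)⟩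
  refine ⟨ProjRes.ofPlotExact (fun n ↦ ⟨P₁.X n × P₃.X n⟩) d ε
    (fun n ↦ (P₁.projective n).prod (P₃.projective n)) hsub h0 hs,
    ⟨fun n ↦ sinl _ _, Linfty.ext fun x ↦ ?_, fun n ↦ Linfty.ext fun x ↦ ?_⟩,
    ⟨fun n ↦ ssnd _ _, Linfty.ext fun x ↦ ?_, fun n ↦ Linfty.ext fun x ↦ ?_⟩,
    fun n ↦ isShortExact_prod, fun n ↦ ⟨sfst _ _, fun x ↦ rfl⟩⟩
  · exact (hε (x, 0)).trans (by simp)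
  · exact (hd n (x, 0)).trans (by simp; rfl)
  · refine Eq.symm ((congrArg π (hε x)).trans ?_)
    rw [map_add, show π (i _) = 0 from hex.comp_apply _, T.π_σ, zero_add]
    rfl
  · exact (congrArg Prod.snd (hd n x)).symm

end Twist

end Connecting

/-! ### The long exact sequence of Ext -/

section LongExact

variable {V V₁ V₂ V₃ W : DVect.{u}}

theorem precomp_injective {X Y : DVect.{u}} {f : Linfty X Y} (hf : Function.Surjective f) :
    Function.Injective (precomp W f) := fun a b h ↦ Linfty.ext fun y ↦ by
  obtain ⟨x, rfl⟩ := hf y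
  exact DFunLike.congr_fun h x

theorem exact_precomp {i : Linfty V₁ V₂} {π : Linfty V₂ V₃} (hex : IsShortExact i.1 π.1) :
    Function.Exact (precomp W π) (precomp W i) := by
  intro b
  constructor
  · intro hb
    refine IsSubduction.exists_factor (f := π) hex.subduction b fun x hx ↦ ?_
    obtain ⟨y, rfl⟩ := (hex.exact x).mp hx
    exact DFunLike.congr_fun hb y
  · rintro ⟨c, rfl⟩
    refine Linfty.ext fun x ↦ ?_
    change c (π (i x)) = 0
    rw [show π (i x) = 0 from hex.comp_apply x, map_zero]

/-- The natural map `L^∞(V, W) → Ext⁰(V, W)`. -/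
def ProjRes.toExtZero (P : ProjRes V) (W : DVect.{u}) : Linfty (Linfty V W) (Ext P W 0) :=
  (P.homComplex W).cls 0 ∘ₛ
    ⟨(precomp W P.ε).1.codRestrict _ fun a ↦ Linfty.ext fun x ↦ by
      change a (P.ε (P.d 0 x)) = 0
      rw [P.ε_d_apply, map_zero], fun n p hp ↦ (precomp W P.ε).2 n p hp⟩

theorem ProjRes.toExtZero_bijective (P : ProjRes V) (W : DVect.{u}) :
    Function.Bijective (P.toExtZero W) := by
  constructor
  · intro a b h
    have h' : precomp W P.ε a - precomp W P.ε b = 0 := DCochain.cls_eq_cls.mp h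
    exact precomp_injective P.subduction_ε.1 (sub_eq_zero.mp h')
  · intro x
    obtain ⟨⟨a, ha⟩, rfl⟩ := DCochain.cls_surjective 0 x
    obtain ⟨b, hb⟩ := P.subduction_ε.exists_factor a fun x hx ↦ by
      obtain ⟨y, rfl⟩ := P.plotExact_zero.exact x hx
      exact P.cocycle_apply ha y
    exact ⟨b, congrArg ((P.homComplex W).cls 0) (Subtype.ext hb)⟩

theorem ProjRes.Lift.extMap_toExtZero {V' : DVect.{u}} {f : Linfty V V'} {P : ProjRes V}
    {Q : ProjRes V'} (F : ProjRes.Lift f P Q) (a : Linfty V' W) :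
    F.extMap W 0 (Q.toExtZero W a) = P.toExtZero W (precomp W f a) :=
  congrArg ((P.homComplex W).cls 0) (Subtype.ext (Linfty.ext fun x ↦ congrArg a (F.ε_apply x)))

theorem Twist.exact_extMap {i : Linfty V₁ V₂} {π : Linfty V₂ V₃} {P₁ : ProjRes V₁}
    {P₃ : ProjRes V₃} (hex : IsShortExact i.1 π.1) (T : Twist i π P₁ P₃)
    (δ : ∀ n, Linfty (Ext P₁ W n) (Ext P₃ W (n + 1)))
    (hδ : ∀ n (a : (P₁.homComplex W).cocycles n),
      δ n ((P₁.homComplex W).cls n a) = (P₃.homComplex W).cls (n + 1)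
        ⟨scomp (V' := P₁.X n) a.1 (T.θ n), T.comp_θ_cocycle (P₁.cocycle_apply a.2)⟩)
    {P₂ : ProjRes V₂} (I : ProjRes.Lift i P₁ P₂) (J : ProjRes.Lift π P₂ P₃) (n : ℕ) :
    Function.Exact (J.extMap W (n + 1)) (I.extMap W (n + 1)) ∧
      Function.Exact (I.extMap W n) (δ n) ∧ Function.Exact (δ n) (J.extMap W (n + 1)) := by
  obtain ⟨P₂', I', J', hIJ, hr⟩ := T.exists_horseshoe hex
  obtain ⟨A⟩ := ProjRes.nonempty_lift (sid V₂) P₂' P₂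
  have hI (n) (x) : I.extMap W n x = I'.extMap W n (A.extMap W n x) := by
    rw [← ProjRes.Lift.extMap_comp]
    exact DFunLike.congr_fun (ProjRes.Lift.extMap_eq (f := i) I (A.comp I') W n) x
  have hJ (n) (x) : A.extMap W n (J.extMap W n x) = J'.extMap W n x := by
    rw [← ProjRes.Lift.extMap_comp]
    exact DFunLike.congr_fun (ProjRes.Lift.extMap_eq (f := π) (J.comp A) J' W n) x
  have hA := A.extMap_bijective W
  have hF (n) : Function.Injective ((J'.cochainMap W).f n) :=
    precomp_injective (hIJ n).surjective
  have hFG (n) : Function.Exact ((J'.cochainMap W).f n) ((I'.cochainMap W).f n) :=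
    exact_precomp (hIJ n)
  have hG (n) : Function.Surjective ((I'.cochainMap W).f n) := fun (a : Linfty (P₁.X n) W) ↦ by
    obtain ⟨r, hr⟩ := hr n
    exact ⟨a ∘ₛ r, Linfty.ext fun x ↦ congrArg a (hr x)⟩
  have hδ' (n) (a : (P₁.homComplex W).cocycles n) (b : Linfty (P₂'.X n) W)
      (c : (P₃.homComplex W).cocycles (n + 1)) (hab : (I'.cochainMap W).f n b = a.1)
      (hbc : (P₂'.homComplex W).d n b = (J'.cochainMap W).f (n + 1) c.1) :
      δ n ((P₁.homComplex W).cls n a) = (P₃.homComplex W).cls (n + 1) c := by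
    rw [hδ]
    exact DCochain.cls_eq_cls.mpr (T.isCob_of_shortExact hex I' J' hIJ (P₁.cocycle_apply a.2)
      (DFunLike.congr_fun hab) (DFunLike.congr_fun hbc))
  refine ⟨fun y ↦ ?_, fun y ↦ ?_, fun x ↦ ?_⟩
  · rw [hI]
    refine (DCochain.exact_map_map hF hFG hG n _).trans ⟨?_, ?_⟩
    · rintro ⟨x, hx⟩
      exact ⟨x, (hA (n + 1)).1 ((hJ _ x).trans hx)⟩
    · rintro ⟨x, rfl⟩
      exact ⟨x, (hJ _ x).symm⟩
  · refine (DCochain.exact_map_connecting hF hFG hG (hδ' n) y).trans ⟨?_, ?_⟩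
    · rintro ⟨x, rfl⟩
      obtain ⟨z, rfl⟩ := (hA n).2 x
      exact ⟨z, hI n z⟩
    · rintro ⟨x, rfl⟩
      exact ⟨_, (hI n x).symm⟩
  · refine Iff.trans ⟨fun hx ↦ ?_, fun hx ↦ (hA (n + 1)).1 ?_⟩
      (DCochain.exact_connecting_map hFG hG hF (hδ' n) x)
    · exact (hJ (n + 1) x).symm.trans ((congrArg _ hx).trans (map_zero _))
    · exact (hJ (n + 1) x).trans (hx.trans (map_zero _).symm)

end LongExact

end DiffVS

end

theorem theorem7p6 (V₁ V₂ V₃ W : DVect.{u}) (i : Linfty V₁ V₂) (π : Linfty V₂ V₃)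
    (hex : IsShortExact i.1 π.1) :
    -- the objects and the induced maps exist and are well defined
    (∀ V : DVect.{u}, Nonempty (ProjRes V)) ∧
    (∀ (V V' : DVect.{u}) (f : Linfty V V') (P : ProjRes V) (Q : ProjRes V'),
      Nonempty (ProjRes.Lift f P Q) ∧
      ∀ (F G : ProjRes.Lift f P Q) (n : ℕ), F.extMap W n = G.extMap W n) ∧
    -- the beginning of the sequence
    Function.Injective (precomp W π) ∧
    Function.Exact (precomp W π) (precomp W i) ∧
    -- the connecting maps and the rest of the sequence
    ∀ (P₁ : ProjRes V₁) (P₃ : ProjRes V₃),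
      ∃ (δ₀ : Linfty (Linfty V₁ W) (Ext P₃ W 1))
        (δ : ∀ n : ℕ, Linfty (Ext P₁ W (n + 1)) (Ext P₃ W (n + 2))),
        ∀ (P₂ : ProjRes V₂) (I : ProjRes.Lift i P₁ P₂) (J : ProjRes.Lift π P₂ P₃),
          Function.Exact (precomp W i) δ₀ ∧
          Function.Exact δ₀ (J.extMap W 1) ∧
          (∀ n : ℕ,
            Function.Exact (J.extMap W (n + 1)) (I.extMap W (n + 1)) ∧
            Function.Exact (I.extMap W (n + 1)) (δ n) ∧
            Function.Exact (δ n) (J.extMap W (n + 2))) ∧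
          -- when the resolutions form a short exact sequence in each degree, `δ₀` and `δ n` are
          -- the connecting maps of the resulting short exact sequence of cochain complexes
          ((∀ n : ℕ, IsShortExact (I.hom n).1 (J.hom n).1) →
            (∀ (a : Linfty V₁ W) (b : Linfty (P₂.X 0) W) (c : (P₃.homComplex W).cocycles 1),
              b ∘ₛ I.hom 0 = a ∘ₛ P₁.ε →
              b ∘ₛ P₂.d 0 = precomp W (J.hom 1) c.1 →
              δ₀ a = (P₃.homComplex W).cls 1 c) ∧
            (∀ (n : ℕ) (a : (P₁.homComplex W).cocycles (n + 1)) (b : Linfty (P₂.X (n + 1)) W)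
                (c : (P₃.homComplex W).cocycles (n + 2)),
              b ∘ₛ I.hom (n + 1) = a.1 →
              b ∘ₛ P₂.d (n + 1) = precomp W (J.hom (n + 2)) c.1 →
              δ n ((P₁.homComplex W).cls (n + 1) a) = (P₃.homComplex W).cls (n + 2) c)) := by
  refine ⟨nonempty_projRes, fun V V' f P Q ↦ ⟨ProjRes.nonempty_lift f P Q, fun F G n ↦
    F.extMap_eq G W n⟩, precomp_injective hex.surjective, exact_precomp hex, fun P₁ P₃ ↦ ?_⟩
  obtain ⟨T⟩ := nonempty_twist hex P₁ P₃
  choose δ hδ using T.exists_connecting W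
  refine ⟨δ 0 ∘ₛ P₁.toExtZero W, fun n ↦ δ (n + 1), fun P₂ I J ↦ ?_⟩
  have hLES := T.exact_extMap hex δ hδ I J
  have hε₁ := P₁.toExtZero_bijective W
  have hε₂ := P₂.toExtZero_bijective W
  refine ⟨fun a ↦ ?_, fun x ↦ ?_, fun n ↦ ⟨(hLES n).1, (hLES (n + 1)).2⟩, fun hIJ ↦ ⟨?_, ?_⟩⟩
  · refine ((hLES 0).2.1 (P₁.toExtZero W a)).trans ⟨?_, ?_⟩
    · rintro ⟨y, hy⟩
      obtain ⟨b, rfl⟩ := hε₂.2 y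
      exact ⟨b, hε₁.1 ((I.extMap_toExtZero b).symm.trans hy)⟩
    · rintro ⟨b, rfl⟩
      exact ⟨P₂.toExtZero W b, I.extMap_toExtZero b⟩
  · refine ((hLES 0).2.2 x).trans ⟨?_, ?_⟩
    · rintro ⟨y, rfl⟩
      obtain ⟨a, rfl⟩ := hε₁.2 y
      exact ⟨a, rfl⟩
    · rintro ⟨a, rfl⟩
      exact ⟨_, rfl⟩
  · intro a b c hab hbc
    refine (hδ 0 _).trans (DCochain.cls_eq_cls.mpr (T.isCob_of_shortExact hex I J hIJ ?_
      (DFunLike.congr_fun hab) (DFunLike.congr_fun hbc)))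
    intro x
    change a (P₁.ε (P₁.d 0 x)) = 0
    rw [P₁.ε_d_apply, map_zero]
  · intro n a b c hab hbc
    exact (hδ (n + 1) a).trans (DCochain.cls_eq_cls.mpr (T.isCob_of_shortExact hex I J hIJ
      (P₁.cocycle_apply a.2) (DFunLike.congr_fun hab) (DFunLike.congr_fun hbc)))
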